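/- For a sequence $c=(c_0,c_1,\dots)$ in a commutative ring and $n\ge 0$ let $H_n(c_k)=\det\big(c_{i+j}\big)_{0\le i,j\le n}$ be its $n$th Hankel determinant, and let $B_k$ denote the $k$th Bernoulli polynomial, defined by $\frac{te^{xt}}{e^t-1}=\sum_{k\ge 0}B_k(x)\frac{t^k}{k!}$. Let $q\ge 1$ and $0\le r<s$ be integers, let $x$ be a complex number or an indeterminate (more generally, any element of a commutative $\mathbb{Q}$-algebra), and set $$b_k=B_k\Big(\frac{x+r}{q}\Big)-B_k\Big(\frac{x+s}{q}\Big),\qquad k=0,1,2,\dots$$ Then for every integer $m\ge 0$ we have $H_{2m}(b_k)=0$ and $$H_{2m+1}(b_k)=(-1)^{m+1}\left(\frac{s-r}{q^{m+1}}\right)^{2m+2}\prod_{\ell=1}^{m}\left(\frac{\ell^4\big((s-r)^2-(q\ell)^2\big)}{4(2\ell+1)(2\ell-1)}\right)^{2(m+1-\ell)}.$$ In particular, these values do not depend on $x$. -/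

import Mathlib

/-- The `n`-th Hankel determinant `H_n(c) = det (c_{i+j})_{0 ≤ i, j ≤ n}` of a sequence
`c = (c_0, c_1, …)`; the matrix has size `n + 1`. -/
def hankelDet {R : Type*} [CommRing R] (c : ℕ → R) (n : ℕ) : R :=
  Matrix.det (Matrix.of fun i j : Fin (n + 1) => c ((i : ℕ) + (j : ℕ)))

/-- `b_k = B_k((x + r) / q) - B_k((x + s) / q)`, where `B_k` is the `k`-th Bernoulli polynomial
and `x` is an element of a commutative `ℚ`-algebra: a number, or an indeterminate. -/
noncomputable def bernoulliDiff {A : Type*} [CommRing A] [Algebra ℚ A] (q r s : ℤ) (x : A)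
    (k : ℕ) : A :=
  Polynomial.aeval ((1 / (q : ℚ)) • (x + (r : A))) (Polynomial.bernoulli k)
    - Polynomial.aeval ((1 / (q : ℚ)) • (x + (s : A))) (Polynomial.bernoulli k)

/-!
Up to translation and sign, the Hankel matrix of `b_k` is built from a Hilbert matrix.

Put `D = (s - r) / q`. Hankel determinants of Appell sequences are invariant under translation of
the argument, since `det (φ (p_i * q_j))` is the same for all families of monic polynomials `p_i`,
`q_j` of degree `i`, `j` (`det_functional_mul_eq_det_functional_X_pow`). So `x` disappears, and
`b_k` may be replaced by the rational number `c_k = B_k((1 - D)/2) - B_k((1 + D)/2)`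
(`hankelDet_bernoulliDiff`). By the reflection formula `c_{2k} = 0` and
`c_{2k+1} = -2 B_{2k+1}((1 + D)/2)`. The vanishing of the even terms gives `H_{2m}(c) = 0`, and
makes the matrix of `H_{2m+1}(c)` the Kronecker product of `(c_{2(i+j)+1})` with the `2 × 2` swap,
so that `H_{2m+1}(c) = (-1)^{m+1} H_m(c_{2k+1})^2` (`hankelDet_odd_eq_sq`).

For the remaining determinant let `L(t^n) = B_{2n+1}(a)` with `a = (1 + D)/2`, and write
`a' = (1 - D)/2`. In the bases `p_k = ∏_{i<k} (t - (a + i)^2)` and `q_j = ∏_{i<j} (t - (a' + i)^2)`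
the Gram matrix is a Hilbert matrix with rescaled rows and columns (`oddBernoulliFunctional_mul`):
`L(p_k q_j) = (D/2) (-1)^{k+j} k! (1 + D)_k j! (1 - D)_j / (k + j + 1)`.
For `j = 0` this holds because the Bernoulli functional `X^n ↦ B_n` sends `G(X + 1) - G(X)` to
`G'(0)`, applied to `G = ∏_{i≤k} (X - i)(X + D + i)`. The general case follows by induction on `j`,
from `p_k q_{j+1} = p_{k+1} q_j + (D + k - j)(1 + k + j) p_k q_j`. The Hilbert determinant is
computed by Schur complements (`det_hilbert`).
-/

/-! ### Gram determinants of a linear functional on polynomials -/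

open Polynomial Matrix in
/-- The Gram determinant of a functional `φ` does not depend on the families of monic polynomials
of degrees `0, 1, 2, …` indexing its rows and columns, because both changes of basis are
unitriangular. -/
theorem det_functional_mul_eq_det_functional_X_pow {R : Type*} [CommRing R]
    (φ : R[X] →ₗ[R] R) (p q : ℕ → R[X])
    (hp : ∀ i, (p i).Monic) (hpd : ∀ i, (p i).natDegree = i)
    (hq : ∀ i, (q i).Monic) (hqd : ∀ i, (q i).natDegree = i) (n : ℕ) :
    det (of fun i j : Fin n => φ (p i * q j)) =
      det (of fun i j : Fin n => φ (X ^ ((i : ℕ) + (j : ℕ)))) := by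
  have expand : ∀ (f : ℕ → R[X]), (∀ i, (f i).natDegree = i) → ∀ i : Fin n,
      f i = ∑ a : Fin n, (f i).coeff a • (X : R[X]) ^ (a : ℕ) := by
    intro f hf i
    rw [Fin.sum_univ_eq_sum_range (fun a => (f i).coeff a • (X : R[X]) ^ a) n]
    simpa only [smul_X_eq_monomial] using
      as_sum_range' (f i) n (by rw [hf]; exact i.isLt)
  have key : (of fun i j : Fin n => φ (p i * q j)) =
      (of fun a i : Fin n => (p i).coeff a)ᵀ *
        (of fun i j : Fin n => φ (X ^ ((i : ℕ) + (j : ℕ)))) *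
        (of fun b j : Fin n => (q j).coeff b) := by
    ext i j
    simp only [Matrix.mul_apply, transpose_apply, of_apply]
    conv_lhs => rw [expand p hpd i, expand q hqd j, Finset.mul_sum, map_sum]
    refine Finset.sum_congr rfl fun b _ => ?_
    rw [Finset.sum_mul, map_sum, Finset.sum_mul]
    refine Finset.sum_congr rfl fun a _ => ?_
    rw [smul_mul_assoc, mul_smul_comm, ← pow_add, map_smul, map_smul, smul_eq_mul, smul_eq_mul]
    ring
  rw [key, det_mul, det_mul, det_transpose,
    det_matrixOfPolynomials (fun i : Fin n => p i) (fun i => hpd i) (fun i => hp i),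
    det_matrixOfPolynomials (fun i : Fin n => q i) (fun i => hqd i) (fun i => hq i), one_mul,
    mul_one]

/-! ### The Bernoulli functional -/

open Polynomial in
/-- The `A`-linear functional on `A[X]` with `X ^ n ↦ B_n`, where `B_n` is the `n`-th Bernoulli
number with the convention `B_1 = -1/2`. -/
noncomputable def bernoulliFunctional (A : Type*) [CommRing A] [Algebra ℚ A] : A[X] →ₗ[A] A :=
  Polynomial.lsum fun n => LinearMap.toSpanSingleton A A (algebraMap ℚ A (bernoulli n))

open Polynomial in
theorem bernoulliFunctional_X_pow {A : Type*} [CommRing A] [Algebra ℚ A] (n : ℕ) :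
    bernoulliFunctional A (X ^ n) = algebraMap ℚ A (_root_.bernoulli n) := by
  simp [bernoulliFunctional, ← monomial_one_right_eq_X_pow, lsum_apply, sum_monomial_index]

open Polynomial in
theorem bernoulliFunctional_X_add_C_pow {A : Type*} [CommRing A] [Algebra ℚ A] (u : A) (n : ℕ) :
    bernoulliFunctional A ((X + C u) ^ n) = aeval u (Polynomial.bernoulli n) := by
  rw [add_pow, map_sum, Polynomial.bernoulli, map_sum]
  refine Finset.sum_congr rfl fun i _ => ?_
  rw [aeval_monomial, ← C_pow, ← map_natCast (C : A →+* A[X]), mul_assoc, ← C_mul, mul_comm,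
    ← smul_eq_C_mul, map_smul, bernoulliFunctional_X_pow, smul_eq_mul]
  rw [map_mul, map_natCast]
  ring

open Polynomial in
/-- On monomials this is the difference equation `B_n(1) - B_n(0) = n * 0 ^ (n - 1)`. -/
theorem bernoulliFunctional_taylor_one_sub (f : ℚ[X]) :
    bernoulliFunctional ℚ (taylor 1 f) - bernoulliFunctional ℚ f = f.derivative.eval 0 := by
  induction f using Polynomial.induction_on' with
  | add p q hp hq =>
    simp only [map_add, eval_add]
    linear_combination hp + hq
  | monomial n c =>
    have h := Polynomial.bernoulli_eval_one_add n 0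
    have h1 := bernoulliFunctional_X_add_C_pow (1 : ℚ) n
    rw [add_zero, ← coe_aeval_eq_eval, ← h1, bernoulli_eval_zero] at h
    rw [← smul_X_eq_monomial, map_smul, map_smul, map_smul, taylor_X_pow, h,
      bernoulliFunctional_X_pow]
    simp only [derivative_smul, derivative_X_pow, eval_smul, eval_mul, eval_C, eval_pow, eval_X,
      smul_eq_mul, eq_ratCast, Rat.cast_id]
    ring

/-! ### Reduction to a rational sequence symmetric about `1 / 2` -/

open Polynomial in
/-- Translating both arguments by `v` amounts to replacing the basis `X ^ i` by `(X + v) ^ i` on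
both sides of the Gram matrix. -/
theorem det_aeval_bernoulli_sub_translate {A : Type*} [CommRing A] [Algebra ℚ A] (u w v : A)
    (n : ℕ) :
    hankelDet (fun k => aeval (u + v) (Polynomial.bernoulli k) -
        aeval (w + v) (Polynomial.bernoulli k)) n =
      hankelDet (fun k => aeval u (Polynomial.bernoulli k) -
        aeval w (Polynomial.bernoulli k)) n := by
  nontriviality A
  have hmon : ∀ i : ℕ, ((X + C v : A[X]) ^ i).Monic := fun i => (monic_X_add_C v).pow i
  have hdeg : ∀ i : ℕ, ((X + C v : A[X]) ^ i).natDegree = i := fun i => by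
    rw [(monic_X_add_C v).natDegree_pow, natDegree_X_add_C, mul_one]
  have h := det_functional_mul_eq_det_functional_X_pow
    (bernoulliFunctional A ∘ₗ taylor u - bernoulliFunctional A ∘ₗ taylor w)
    _ _ hmon hdeg hmon hdeg (n + 1)
  have ht : ∀ (y : A) (k : ℕ), taylor y ((X + C v : A[X]) ^ k) = (X + C (y + v)) ^ k := by
    intro y k
    rw [taylor_pow, map_add, taylor_X, taylor_C, add_assoc, ← C_add]
  simp only [← pow_add, LinearMap.sub_apply, LinearMap.comp_apply, ht, taylor_X_pow,
    bernoulliFunctional_X_add_C_pow] at h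
  exact h

theorem hankelDet_map {R S : Type*} [CommRing R] [CommRing S] (f : R →+* S) (c : ℕ → R) (n : ℕ) :
    hankelDet (fun k => f (c k)) n = f (hankelDet c n) := by
  rw [hankelDet, hankelDet, RingHom.map_det]
  rfl

open Polynomial in
/-- After translation the two arguments are `(1 ∓ D) / 2` with `D = (s - r) / q`, symmetric about
`1 / 2`. -/
theorem hankelDet_bernoulliDiff {A : Type*} [CommRing A] [Algebra ℚ A] (q r s : ℤ) (x : A)
    (n : ℕ) :
    hankelDet (bernoulliDiff q r s x) n =
      algebraMap ℚ A (hankelDet (fun k =>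
        (Polynomial.bernoulli k).eval ((1 - ((s : ℚ) - r) / q) / 2) -
          (Polynomial.bernoulli k).eval ((1 + ((s : ℚ) - r) / q) / 2)) n) := by
  set D : ℚ := ((s : ℚ) - r) / q with hD
  set u : A := (1 / (q : ℚ)) • (x + (r : A)) with hu
  have hw : (1 / (q : ℚ)) • (x + (s : A)) = u + algebraMap ℚ A D := by
    have h1 : ∀ z : ℤ, (z : A) = algebraMap ℚ A z := fun z => by simp
    rw [hu, hD, Algebra.smul_def, Algebra.smul_def, h1, h1, mul_add, mul_add, ← map_mul,
      ← map_mul, add_assoc, ← map_add]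
    congr 2
    ring
  have h1 := det_aeval_bernoulli_sub_translate u (u + algebraMap ℚ A D)
    (algebraMap ℚ A ((1 - D) / 2) - u) n
  have e1 : u + (algebraMap ℚ A ((1 - D) / 2) - u) = algebraMap ℚ A ((1 - D) / 2) := by ring
  have e2 : u + algebraMap ℚ A D + (algebraMap ℚ A ((1 - D) / 2) - u) =
      algebraMap ℚ A ((1 + D) / 2) := by
    rw [show (1 + D) / 2 = (1 - D) / 2 + D by ring, map_add]
    ring
  rw [e1, e2] at h1
  rw [← hankelDet_map]
  simp only [aeval_algebraMap_apply_eq_algebraMap_eval, ← map_sub] at h1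
  rw [h1]
  congr 1
  funext k
  rw [bernoulliDiff, hw]

/-! ### Hankel determinants of sequences with vanishing even terms -/

/-- Conjugating the Hankel matrix by `diag ((-1) ^ i)` changes its sign, and its size is odd. -/
theorem hankelDet_even_eq_zero {R : Type*} [CommRing R] [NoZeroDivisors R] [CharZero R]
    (c : ℕ → R) (hc : ∀ k, c (2 * k) = 0) (m : ℕ) : hankelDet c (2 * m) = 0 := by
  set M : Matrix (Fin (2 * m + 1)) (Fin (2 * m + 1)) R :=
    Matrix.of fun i j => c ((i : ℕ) + (j : ℕ)) with hM
  set S : Matrix (Fin (2 * m + 1)) (Fin (2 * m + 1)) R :=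
    Matrix.diagonal fun i => (-1) ^ (i : ℕ) with hS
  have h : M = -(S * M * S) := by
    ext i j
    simp only [hM, hS, Matrix.neg_apply, Matrix.mul_diagonal, Matrix.diagonal_mul, Matrix.of_apply]
    rcases Nat.even_or_odd ((i : ℕ) + (j : ℕ)) with he | ho
    · obtain ⟨k, hk⟩ := he
      rw [hk, ← two_mul, hc]
      simp
    · rw [mul_right_comm, ← pow_add, ho.neg_one_pow]
      ring
  have hSS : S * S = 1 := by
    rw [hS, Matrix.diagonal_mul_diagonal, ← Matrix.diagonal_one]
    congr 1
    funext i
    rw [← mul_pow, neg_one_mul, neg_neg, one_pow]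
  have h2 := congrArg Matrix.det h
  rw [Matrix.det_neg, Matrix.det_mul_right_comm, ← Matrix.mul_one M, hSS] at h2
  rw [Fintype.card_fin, Odd.neg_one_pow ⟨m, rfl⟩, Matrix.mul_one, one_mul, neg_one_mul] at h2
  exact self_eq_neg.mp h2

open scoped Kronecker in
/-- Grouping the indices as `2 * i + ε` with `ε < 2` turns the matrix into a Kronecker product with
the `2 × 2` swap. -/
theorem hankelDet_odd_eq_sq {R : Type*} [CommRing R]
    (c : ℕ → R) (hc : ∀ k, c (2 * k) = 0) (m : ℕ) :
    hankelDet c (2 * m + 1) = (-1) ^ (m + 1) * hankelDet (fun k => c (2 * k + 1)) m ^ 2 := by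
  have h : ((Matrix.of fun i j : Fin ((m + 1) * 2) => c ((i : ℕ) + (j : ℕ))).submatrix
      finProdFinEquiv finProdFinEquiv) =
      (Matrix.of fun i j : Fin (m + 1) => c (2 * ((i : ℕ) + (j : ℕ)) + 1)) ⊗ₖ
        (!![0, 1; 1, 0] : Matrix (Fin 2) (Fin 2) R) := by
    ext ⟨i, a⟩ ⟨j, b⟩
    fin_cases a <;> fin_cases b <;>
      simp [finProdFinEquiv, Matrix.kroneckerMap_apply, ← mul_add, hc]
    · congr 1
      ring
    · congr 1
      ring
    · rw [show 1 + 2 * (i : ℕ) + (1 + 2 * (j : ℕ)) = 2 * (1 + i + j) by ring, hc]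
  have h2 := congrArg Matrix.det h
  rw [Matrix.det_submatrix_equiv_self, Matrix.det_kronecker, Matrix.det_fin_two_of] at h2
  simp only [Fintype.card_fin, mul_zero, mul_one, zero_sub] at h2
  rw [mul_comm ((-1 : R) ^ (m + 1))]
  have hsize : 2 * m + 1 + 1 = (m + 1) * 2 := by ring
  rw [hankelDet, hsize]
  exact h2


/-! ### The determinant of the Hilbert matrix -/

theorem prod_range_sub_div_add_one_add (n : ℕ) :
    ∏ i ∈ Finset.range n, (((n : ℚ) - i) / (n + i + 1)) = (n.centralBinom : ℚ)⁻¹ := by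
  have h1 : ∏ i ∈ Finset.range n, ((n : ℚ) - i) = (n.factorial : ℚ) := by
    rw [← Nat.descFactorial_self n, Nat.descFactorial_eq_prod_range, Nat.cast_prod]
    refine Finset.prod_congr rfl fun i hi => ?_
    rw [Nat.cast_sub (Finset.mem_range.mp hi).le]
  have h2 : ∏ i ∈ Finset.range n, ((n : ℚ) + i + 1) = ((n + 1).ascFactorial n : ℚ) := by
    rw [Nat.ascFactorial_eq_prod_range, Nat.cast_prod]
    refine Finset.prod_congr rfl fun i _ => ?_
    push_cast
    ring
  have h3 : ((n + 1).ascFactorial n : ℚ) = n.factorial * n.centralBinom := by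
    rw [Nat.ascFactorial_eq_factorial_mul_choose, Nat.centralBinom, two_mul, Nat.cast_mul]
  have h4 : (n.factorial : ℚ) ≠ 0 := by exact_mod_cast n.factorial_ne_zero
  rw [Finset.prod_div_distrib, h1, h2, h3, div_mul_eq_div_div, div_self h4, one_div]

open Matrix in
/-- The Schur complement of the last diagonal entry of a Hilbert matrix is the next smaller Hilbert
matrix, with row `i` and column `i` both scaled by `(n - i) / (n + i + 1)`. -/
theorem det_hilbert_succ (n : ℕ) :
    det (of fun i j : Fin (n + 1) => (1 : ℚ) / ((i : ℕ) + (j : ℕ) + 1)) =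
      1 / ((2 * n + 1) * (n.centralBinom : ℚ) ^ 2) *
        det (of fun i j : Fin n => (1 : ℚ) / ((i : ℕ) + (j : ℕ) + 1)) := by
  have hn : ((n : ℚ) + n + 1) ≠ 0 := by positivity
  have hblock : (of fun i j : Fin (n + 1) => (1 : ℚ) / ((i : ℕ) + (j : ℕ) + 1)).submatrix
      finSumFinEquiv finSumFinEquiv =
      fromBlocks (of fun i j : Fin n => (1 : ℚ) / ((i : ℕ) + (j : ℕ) + 1))
        (of fun (i : Fin n) (_ : Fin 1) => (1 : ℚ) / ((i : ℕ) + n + 1))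
        (of fun (_ : Fin 1) (j : Fin n) => (1 : ℚ) / (n + (j : ℕ) + 1))
        (diagonal fun _ : Fin 1 => (1 : ℚ) / (n + n + 1)) := by
    ext (i | i) (j | j) <;> simp
    rw [Subsingleton.elim i j, Matrix.diagonal_apply_eq]
  let : Invertible (diagonal fun _ : Fin 1 => (1 : ℚ) / (n + n + 1)) :=
    ⟨diagonal fun _ => (n : ℚ) + n + 1,
      by rw [diagonal_mul_diagonal, mul_one_div_cancel hn, diagonal_one],
      by rw [diagonal_mul_diagonal, one_div_mul_cancel hn, diagonal_one]⟩
  have hinv : ⅟(diagonal fun _ : Fin 1 => (1 : ℚ) / (n + n + 1)) =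
      diagonal fun _ => (n : ℚ) + n + 1 := rfl
  have hschur : (of fun i j : Fin n => (1 : ℚ) / ((i : ℕ) + (j : ℕ) + 1)) -
      (of fun (i : Fin n) (_ : Fin 1) => (1 : ℚ) / ((i : ℕ) + n + 1)) *
        ⅟(diagonal fun _ : Fin 1 => (1 : ℚ) / (n + n + 1)) *
        (of fun (_ : Fin 1) (j : Fin n) => (1 : ℚ) / (n + (j : ℕ) + 1)) =
      of fun i j : Fin n => (((n : ℚ) - (j : ℕ)) / (n + (j : ℕ) + 1)) *
        (of fun i j : Fin n => (((n : ℚ) - (i : ℕ)) / (n + (i : ℕ) + 1)) *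
          (of fun i j : Fin n => (1 : ℚ) / ((i : ℕ) + (j : ℕ) + 1)) i j) i j := by
    rw [hinv]
    ext i j
    have h1 : ((i : ℕ) : ℚ) + (j : ℕ) + 1 ≠ 0 := by positivity
    have h2 : (n : ℚ) + (i : ℕ) + 1 ≠ 0 := by positivity
    have h3 : (n : ℚ) + (j : ℕ) + 1 ≠ 0 := by positivity
    have h4 : ((i : ℕ) : ℚ) + n + 1 ≠ 0 := by positivity
    simp [Matrix.mul_apply]
    field_simp
    ring
  rw [← det_submatrix_equiv_self finSumFinEquiv, hblock, det_fromBlocks₂₂, hschur, det_mul_row,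
    det_mul_column, Fin.prod_univ_eq_prod_range (fun i : ℕ => ((n : ℚ) - i) / (n + i + 1)) n,
    prod_range_sub_div_add_one_add, det_diagonal]
  simp only [Finset.univ_unique, Finset.prod_const, Finset.card_singleton, pow_one]
  field_simp
  ring

theorem det_hilbert (n : ℕ) :
    Matrix.det (Matrix.of fun i j : Fin n => (1 : ℚ) / ((i : ℕ) + (j : ℕ) + 1)) =
      ∏ k ∈ Finset.range n, 1 / ((2 * k + 1) * (k.centralBinom : ℚ) ^ 2) := by
  induction n with
  | zero => simp
  | succ n ih => rw [det_hilbert_succ, ih, Finset.prod_range_succ, mul_comm]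

/-! ### The functional with moments `B_{2n+1}(a)` -/

open Polynomial in
/-- The monic polynomial `∏_{i < k} (t - (a + i) ^ 2)`; at `t = z ^ 2` it is
`(-1) ^ k (a + z)_k (a - z)_k` in terms of rising factorials. -/
noncomputable def shiftedSquareProd (a : ℚ) (k : ℕ) : ℚ[X] :=
  ∏ i ∈ Finset.range k, (X - C ((a + i) ^ 2))

open Polynomial in
theorem shiftedSquareProd_monic (a : ℚ) (k : ℕ) : (shiftedSquareProd a k).Monic :=
  monic_prod_of_monic _ _ fun _ _ => monic_X_sub_C _

open Polynomial in
theorem natDegree_shiftedSquareProd (a : ℚ) (k : ℕ) : (shiftedSquareProd a k).natDegree = k := by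
  rw [shiftedSquareProd, natDegree_prod_of_monic _ _ fun _ _ => monic_X_sub_C _]
  simp only [natDegree_X_sub_C, Finset.sum_const, Finset.card_range, smul_eq_mul, mul_one]

open Polynomial in
/-- The linear functional with `t ^ n ↦ B_{2n+1}(a)`, realised as the Bernoulli functional of
`(X + a) * f ((X + a) ^ 2)`. -/
noncomputable def oddBernoulliFunctional (a : ℚ) : ℚ[X] →ₗ[ℚ] ℚ :=
  bernoulliFunctional ℚ ∘ₗ LinearMap.mulLeft ℚ (X + C a) ∘ₗ
    (aeval ((X + C a : ℚ[X]) ^ 2)).toLinearMap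

open Polynomial in
theorem oddBernoulliFunctional_apply (a : ℚ) (f : ℚ[X]) :
    oddBernoulliFunctional a f = bernoulliFunctional ℚ ((X + C a) * f.comp ((X + C a) ^ 2)) :=
  rfl

open Polynomial in
theorem oddBernoulliFunctional_X_pow (a : ℚ) (n : ℕ) :
    oddBernoulliFunctional a (X ^ n) = (Polynomial.bernoulli (2 * n + 1)).eval a := by
  rw [oddBernoulliFunctional_apply, X_pow_comp, ← pow_mul, ← pow_succ',
    bernoulliFunctional_X_add_C_pow, coe_aeval_eq_eval]

open Polynomial in
/-- With `G = ∏_{i ≤ k} (X - i) (X + D + i)`, the difference `G(X + 1) - G(X)` is `2 (k + 1)` times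
the polynomial to which the Bernoulli functional is applied, so the value is
`G'(0) / (2 (k + 1))`. -/
theorem oddBernoulliFunctional_shiftedSquareProd (D : ℚ) (k : ℕ) :
    oddBernoulliFunctional ((1 + D) / 2) (shiftedSquareProd ((1 + D) / 2) k) =
      D / 2 * (-1) ^ k * k.factorial * (∏ i ∈ Finset.range k, (1 + D + i)) / (k + 1) := by
  set a : ℚ := (1 + D) / 2 with ha
  set E : ℚ[X] := ∏ i ∈ Finset.range k, (X - C (i : ℚ)) with hE
  set F : ℚ[X] := ∏ i ∈ Finset.range k, (X + C (1 + D + i)) with hF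
  set G : ℚ[X] := (∏ i ∈ Finset.range (k + 1), (X - C (i : ℚ))) *
    ∏ i ∈ Finset.range (k + 1), (X + C (D + i)) with hG
  have hcomp : (shiftedSquareProd a k).comp ((X + C a) ^ 2) = E * F := by
    rw [shiftedSquareProd, prod_comp, hE, hF, ← Finset.prod_mul_distrib]
    refine Finset.prod_congr rfl fun i _ => ?_
    rw [sub_comp, X_comp, C_comp, show 1 + D + (i : ℚ) = 2 * a + i by rw [ha]; ring]
    simp only [C_add, C_mul, C_pow, C_ofNat]
    ring
  have hG0 : G = E * (X - C (k : ℚ)) * ((X + C D) * F) := by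
    rw [hG, Finset.prod_range_succ, Finset.prod_range_succ', hE, hF, mul_comm (X + C D)]
    simp only [Nat.cast_zero, add_zero, Nat.cast_add, Nat.cast_one]
    congr 2
    refine Finset.prod_congr rfl fun i _ => ?_
    congr 2
    ring
  have hG1 : taylor 1 G = (X + 1) * E * (F * (X + C (1 + D + k))) := by
    rw [hG, taylor_apply, mul_comp, prod_comp, prod_comp, Finset.prod_range_succ', hE, hF,
      Finset.prod_range_succ, mul_comm (X + 1)]
    simp only [map_add, add_comp, sub_comp, X_comp, C_comp, one_comp, Nat.cast_zero,
      Nat.cast_add, Nat.cast_one,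
      map_one, map_zero, sub_zero]
    congr 2
    · exact Finset.prod_congr rfl fun i _ => by ring
    · exact Finset.prod_congr rfl fun i _ => by ring
    · ring
  have hdiff : taylor 1 G - G = (2 * (k + 1) : ℚ) • ((X + C a) * (E * F)) := by
    have hD : D = 2 * a - 1 := by rw [ha]; ring
    rw [hG1, hG0, smul_eq_C_mul, hD]
    simp only [C_add, C_mul, C_sub, C_ofNat, C_1]
    ring
  have hder : G.derivative.eval 0 =
      D * ((-1) ^ k * k.factorial * ∏ i ∈ Finset.range k, (1 + D + i)) := by
    have hX : G = X * ((∏ i ∈ Finset.range k, (X - C ((i : ℚ) + 1))) * ((X + C D) * F)) := by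
      rw [hG, Finset.prod_range_succ', Finset.prod_range_succ', hF]
      simp only [Nat.cast_zero, add_zero, Nat.cast_add, Nat.cast_one, map_zero, sub_zero]
      rw [show ∏ i ∈ Finset.range k, (X + C (D + ((i : ℚ) + 1))) =
        ∏ i ∈ Finset.range k, (X + C (1 + D + (i : ℚ))) from
          Finset.prod_congr rfl fun i _ => by rw [show D + ((i : ℚ) + 1) = 1 + D + i by ring]]
      ring
    have hfac : ∏ i ∈ Finset.range k, (-((i : ℚ) + 1)) = (-1) ^ k * k.factorial := by
      rw [Finset.prod_neg, Finset.card_range, ← Finset.prod_range_add_one_eq_factorial]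
      push_cast
      rfl
    rw [hX, derivative_mul, derivative_X, eval_add, eval_mul, eval_mul (p := X), eval_X, zero_mul,
      add_zero, eval_one, one_mul, hF]
    simp only [eval_mul, eval_prod, eval_sub, eval_add, eval_X, eval_C, zero_sub, zero_add]
    rw [hfac]
    ring
  have h := bernoulliFunctional_taylor_one_sub G
  rw [← map_sub, hdiff, map_smul, hder, smul_eq_mul] at h
  have hk : (k : ℚ) + 1 ≠ 0 := by positivity
  rw [oddBernoulliFunctional_apply, hcomp]
  field_simp
  linear_combination h

open Polynomial in
/-- The Gram matrix of the two bases is a Hilbert matrix with rescaled rows and columns. -/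
theorem oddBernoulliFunctional_mul (D : ℚ) (k j : ℕ) :
    oddBernoulliFunctional ((1 + D) / 2)
        (shiftedSquareProd ((1 + D) / 2) k * shiftedSquareProd ((1 - D) / 2) j) =
      D / 2 * ((-1) ^ k * k.factorial * ∏ i ∈ Finset.range k, (1 + D + i)) *
        ((-1) ^ j * j.factorial * ∏ i ∈ Finset.range j, (1 - D + i)) * (1 / (k + j + 1)) := by
  induction j generalizing k with
  | zero =>
    rw [shiftedSquareProd.eq_def ((1 - D) / 2), Finset.prod_range_zero, mul_one,
      oddBernoulliFunctional_shiftedSquareProd]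
    simp
    ring
  | succ j ih =>
    have hrec : shiftedSquareProd ((1 + D) / 2) k * shiftedSquareProd ((1 - D) / 2) (j + 1) =
        shiftedSquareProd ((1 + D) / 2) (k + 1) * shiftedSquareProd ((1 - D) / 2) j +
        ((D + k - j) * (1 + k + j)) •
          (shiftedSquareProd ((1 + D) / 2) k * shiftedSquareProd ((1 - D) / 2) j) := by
      have hC : C ((((1 + D) / 2) + k) ^ 2) =
          C ((((1 - D) / 2) + j) ^ 2) + C ((D + k - j) * (1 + k + j)) := by
        rw [← C_add]
        congr 1
        ring
      simp only [shiftedSquareProd, Finset.prod_range_succ, smul_eq_C_mul]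
      rw [hC]
      ring
    rw [hrec, map_add, map_smul, ih, ih, smul_eq_mul, Finset.prod_range_succ _ k,
      Finset.prod_range_succ _ j, Nat.factorial_succ, Nat.factorial_succ]
    have h1 : (k : ℚ) + j + 1 ≠ 0 := by positivity
    have h2 : (k : ℚ) + 1 + j + 1 ≠ 0 := by positivity
    have h3 : (k : ℚ) + (j + 1) + 1 ≠ 0 := by positivity
    push_cast
    field_simp
    ring

/-! ### Evaluation of the determinants -/

/-- The `k`-th row factor, column factor and Hilbert factor combine to a product of rational
functions of `l ≤ k`. -/
theorem oddBernoulli_pivot (D : ℚ) (k : ℕ) :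
    D / 2 * ((-1) ^ k * k.factorial * ∏ i ∈ Finset.range k, (1 + D + i)) *
        ((-1) ^ k * k.factorial * ∏ i ∈ Finset.range k, (1 - D + i)) *
        (1 / ((2 * k + 1) * (k.centralBinom : ℚ) ^ 2)) =
      D / 2 * ∏ l ∈ Finset.Icc 1 k,
        (-((l : ℚ) ^ 4 * (D ^ 2 - (l : ℚ) ^ 2) / (4 * (2 * l + 1) * (2 * l - 1)))) := by
  induction k with
  | zero => simp
  | succ k ih =>
    rw [Finset.prod_Icc_succ_top (by omega), ← mul_assoc (D / 2) (Finset.prod _ _), ← ih,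
      Finset.prod_range_succ, Finset.prod_range_succ, Nat.factorial_succ]
    have hb : (k.succ.centralBinom : ℚ) = 2 * (2 * k + 1) * k.centralBinom / (k + 1) := by
      have h := Nat.succ_mul_centralBinom_succ k
      have hk : (k : ℚ) + 1 ≠ 0 := by positivity
      rw [eq_div_iff hk, mul_comm]
      exact_mod_cast h
    have hc : (k.centralBinom : ℚ) ≠ 0 := by exact_mod_cast k.centralBinom_ne_zero
    have h1 : (k : ℚ) + 1 ≠ 0 := by positivity
    have h2 : 2 * (k : ℚ) + 1 ≠ 0 := by positivity
    have h3 : 2 * ((k : ℚ) + 1) + 1 ≠ 0 := by positivity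
    have h4 : 2 * ((k : ℚ) + 1) - 1 ≠ 0 := by ring_nf; positivity
    rw [hb]
    push_cast
    field_simp
    ring

theorem hankelDet_bernoulli_odd (D : ℚ) (m : ℕ) :
    hankelDet (fun k => (Polynomial.bernoulli (2 * k + 1)).eval ((1 + D) / 2)) m =
      ∏ k ∈ Finset.range (m + 1), (D / 2 * ∏ l ∈ Finset.Icc 1 k,
        (-((l : ℚ) ^ 4 * (D ^ 2 - (l : ℚ) ^ 2) / (4 * (2 * l + 1) * (2 * l - 1))))) := by
  have h := det_functional_mul_eq_det_functional_X_pow (oddBernoulliFunctional ((1 + D) / 2))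
    _ _ (shiftedSquareProd_monic ((1 + D) / 2)) (natDegree_shiftedSquareProd ((1 + D) / 2))
    (shiftedSquareProd_monic ((1 - D) / 2)) (natDegree_shiftedSquareProd ((1 - D) / 2)) (m + 1)
  simp only [oddBernoulliFunctional_X_pow] at h
  rw [hankelDet, ← h]
  have hfac : (Matrix.of fun i j : Fin (m + 1) => oddBernoulliFunctional ((1 + D) / 2)
        (shiftedSquareProd ((1 + D) / 2) i * shiftedSquareProd ((1 - D) / 2) j)) =
      Matrix.of fun i j : Fin (m + 1) =>
        (fun j : ℕ => (-1 : ℚ) ^ j * j.factorial * ∏ i ∈ Finset.range j, (1 - D + i)) j *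
        (Matrix.of fun i j : Fin (m + 1) =>
          (fun k : ℕ => D / 2 * ((-1 : ℚ) ^ k * k.factorial *
            ∏ i ∈ Finset.range k, (1 + D + i))) i *
          (Matrix.of fun i j : Fin (m + 1) => (1 : ℚ) / ((i : ℕ) + (j : ℕ) + 1)) i j) i j := by
    ext i j
    rw [Matrix.of_apply, oddBernoulliFunctional_mul]
    simp only [Matrix.of_apply]
    ring
  rw [hfac, Matrix.det_mul_row, Matrix.det_mul_column, det_hilbert,
    Fin.prod_univ_eq_prod_range (fun j : ℕ => (-1 : ℚ) ^ j * j.factorial *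
      ∏ i ∈ Finset.range j, (1 - D + i)),
    Fin.prod_univ_eq_prod_range (fun k : ℕ => D / 2 * ((-1 : ℚ) ^ k * k.factorial *
      ∏ i ∈ Finset.range k, (1 + D + i))), ← Finset.prod_mul_distrib, ← Finset.prod_mul_distrib]
  refine Finset.prod_congr rfl fun k _ => ?_
  rw [← oddBernoulli_pivot]
  ring

theorem prod_range_prod_Icc {M : Type*} [CommMonoid M] (f : ℕ → M) (m : ℕ) :
    ∏ k ∈ Finset.range (m + 1), ∏ l ∈ Finset.Icc 1 k, f l =
      ∏ l ∈ Finset.Icc 1 m, f l ^ (m + 1 - l) := by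
  induction m with
  | zero => simp
  | succ m ih =>
    rw [Finset.prod_range_succ, ih, Finset.prod_Icc_succ_top (by omega),
      Finset.prod_Icc_succ_top (by omega), ← mul_assoc, ← Finset.prod_mul_distrib,
      show m + 1 + 1 - (m + 1) = 1 by omega, pow_one]
    congr 1
    refine Finset.prod_congr rfl fun l hl => ?_
    have := (Finset.mem_Icc.mp hl).2
    rw [← pow_succ, show m + 1 + 1 - l = m + 1 - l + 1 by omega]

theorem theorem3p3 {A : Type*} [CommRing A] [Algebra ℚ A] (q r s : ℤ) (hq : 1 ≤ q) (hr : 0 ≤ r)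
    (hrs : r < s) (x : A) (m : ℕ) :
    hankelDet (bernoulliDiff q r s x) (2 * m) = 0 ∧
    hankelDet (bernoulliDiff q r s x) (2 * m + 1) =
      algebraMap ℚ A
        ((-1 : ℚ) ^ (m + 1) * (((s : ℚ) - (r : ℚ)) / (q : ℚ) ^ (m + 1)) ^ (2 * m + 2) *
          ∏ l ∈ Finset.Icc 1 m,
            ((l : ℚ) ^ 4 * (((s : ℚ) - (r : ℚ)) ^ 2 - ((q : ℚ) * (l : ℚ)) ^ 2) /
              (4 * (2 * (l : ℚ) + 1) * (2 * (l : ℚ) - 1))) ^ (2 * (m + 1 - l))) := by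
  have hq0 : (q : ℚ) ≠ 0 := by exact_mod_cast (by omega : q ≠ 0)
  set D : ℚ := ((s : ℚ) - r) / q with hD
  have hrefl : ∀ k, (Polynomial.bernoulli k).eval ((1 - D) / 2) =
      (-1) ^ k * (Polynomial.bernoulli k).eval ((1 + D) / 2) := fun k => by
    rw [← Polynomial.bernoulli_eval_one_sub]
    congr 1
    ring
  have heven : ∀ k, (Polynomial.bernoulli (2 * k)).eval ((1 - D) / 2) -
      (Polynomial.bernoulli (2 * k)).eval ((1 + D) / 2) = 0 := fun k => by
    rw [hrefl, pow_mul, neg_one_sq, one_pow, one_mul, sub_self]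
  have hodd : ∀ k, (Polynomial.bernoulli (2 * k + 1)).eval ((1 - D) / 2) -
      (Polynomial.bernoulli (2 * k + 1)).eval ((1 + D) / 2) =
      -2 * (Polynomial.bernoulli (2 * k + 1)).eval ((1 + D) / 2) := fun k => by
    rw [hrefl, pow_succ, pow_mul, neg_one_sq, one_pow]
    ring
  rw [hankelDet_bernoulliDiff, hankelDet_bernoulliDiff, ← hD]
  refine ⟨?_, ?_⟩
  · rw [hankelDet_even_eq_zero _ heven, map_zero]
  · congr 1
    rw [hankelDet_odd_eq_sq _ heven]
    simp only [hodd]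
    have hscale : hankelDet (fun k => -2 *
        (Polynomial.bernoulli (2 * k + 1)).eval ((1 + D) / 2)) m = (-2) ^ (m + 1) *
        hankelDet (fun k => (Polynomial.bernoulli (2 * k + 1)).eval ((1 + D) / 2)) m := by
      have h := Matrix.det_smul (Matrix.of fun i j : Fin (m + 1) =>
        (Polynomial.bernoulli (2 * ((i : ℕ) + (j : ℕ)) + 1)).eval ((1 + D) / 2)) (-2 : ℚ)
      rw [Fintype.card_fin] at h
      exact h
    have hl : ∀ l : ℕ, ((l : ℚ) ^ 4 * (((s : ℚ) - r) ^ 2 - ((q : ℚ) * l) ^ 2) /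
        (4 * (2 * (l : ℚ) + 1) * (2 * (l : ℚ) - 1))) ^ 2 = (q : ℚ) ^ 4 *
        (-((l : ℚ) ^ 4 * (D ^ 2 - (l : ℚ) ^ 2) / (4 * (2 * l + 1) * (2 * l - 1)))) ^ 2 := by
      intro l
      rw [show (s : ℚ) - r = q * D by rw [hD]; field_simp]
      ring
    have hqpow : ∏ k ∈ Finset.range (m + 1), ∏ l ∈ Finset.Icc 1 k, (q : ℚ) ^ 4 =
        (q : ℚ) ^ (2 * m * (m + 1)) := by
      simp only [Finset.prod_const, Nat.card_Icc, Nat.add_sub_cancel, ← pow_mul,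
        Finset.prod_pow_eq_pow_sum]
      rw [← Finset.mul_sum, mul_assoc 2 m, mul_comm m]
      have h := Finset.sum_range_id_mul_two (m + 1)
      rw [Nat.add_sub_cancel] at h
      rw [← h]
      congr 1
      ring
    rw [hscale, hankelDet_bernoulli_odd, Finset.prod_mul_distrib, Finset.prod_const,
      Finset.card_range, mul_assoc ((-1 : ℚ) ^ (m + 1))]
    congr 1
    simp only [pow_mul, hl]
    rw [← prod_range_prod_Icc]
    simp only [Finset.prod_mul_distrib]
    rw [hqpow]
    simp only [Finset.prod_pow]
    rw [show (s : ℚ) - r = q * D by rw [hD]; field_simp]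
    -- The powers of `q` cancel: `(m + 1) (2 m + 2) = (2 m + 2) + 2 m (m + 1)`.
    have e : ((q : ℚ) * D / q ^ (m + 1)) ^ (2 * m + 2) * q ^ (2 * m * (m + 1)) =
        ((-2) ^ (m + 1) * (D / 2) ^ (m + 1)) ^ 2 := by
      rw [← mul_pow, show -2 * (D / 2) = -D by ring, ← pow_mul, mul_comm (m + 1) 2, pow_mul (-D),
        neg_sq, ← pow_mul, pow_succ (q : ℚ) m, mul_comm ((q : ℚ) ^ m),
        mul_div_mul_left _ _ hq0, div_pow, ← pow_mul, show m * (2 * m + 2) = 2 * m * (m + 1) by ring,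
        div_mul_cancel₀ _ (pow_ne_zero _ hq0)]
      rfl
    rw [← mul_assoc (_ ^ (2 * m + 2)), e]
    ring
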